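/- Let $\mathfrak g^\sigma$ be a finite-dimensional semisimple real Lie algebra, $\mathfrak g=\mathbb C\otimes_{\mathbb R}\mathfrak g^\sigma$ its complexification and $\sigma$ the conjugation of $\mathfrak g$ that fixes $\mathfrak g^\sigma$. A CR algebra $(\mathfrak g^\sigma,\mathfrak q)$ consists of $\mathfrak g^\sigma$ and a complex Lie subalgebra $\mathfrak q$ of $\mathfrak g$; it is parabolic if $\mathfrak q$ contains a Borel (i.e. maximal solvable) subalgebra of $\mathfrak g$. A homomorphism $(\mathfrak g^\sigma,\mathfrak q)\to(\mathfrak g^\sigma,\mathfrak q')$ of CR algebras is a homomorphism $f:\mathfrak g^\sigma\to\mathfrak g^\sigma$ of real Lie algebras whose complexification $f_{\mathbb C}$ satisfies $f_{\mathbb C}(\mathfrak q)\subseteq\mathfrak q'$; it is $\mathfrak g^\sigma$-equivariant if $f([x,y])=[x,f(y)]$ for all $x,y\in\mathfrak g^\sigma$, and onto if $f$ is surjective. Its fibration is CR if the map $\mathfrak g/(\mathfrak q\cap\sigma(\mathfrak q))\to\mathfrak g/(\mathfrak q'\cap\sigma(\mathfrak q'))$ induced by $f_{\mathbb C}$ maps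 the image of $\mathfrak q$ (the space $T^{0,1}$ at the base point) onto the image of $\mathfrak q'$. Let $\mathfrak h$ be the complexification of a Cartan subalgebra of $\mathfrak g^\sigma$, let $\mathcal R$ be the root system of $(\mathfrak g,\mathfrak h)$ with root spaces $\mathfrak g_\beta$, and let $\sigma$ act on linear forms on $\mathfrak h$ by $\sigma(\alpha)(X)=\overline{\alpha(\sigma(X))}$. Let $\mathcal B$ be the basis of simple roots of a Weyl chamber, for instance of one adapted to $\sigma$ (that is, such that $\sigma(\alpha)$ is positive for every positive root $\alpha$ with $\sigma(\alpha)\neq-\alpha$). Write $\beta=\sum_{\alpha\in\mathcal B}n_{\beta,\alpha}\alpha$ for $\beta\in\mathcal R$, and for $\phi\subseteq\mathcal B$ put $$\mathcal Q_\phi=\{\beta\in\mathcal R\mid n_{\beta,\alpha}\ge 0\ \text{for all }\alpha\in\phi\},\qquad \mathcal Q^n_\phi=\{\beta\in\mathcal Q_\phi\mid -\beta\notin\mathcal Q_\phi\},\qquad \mathfrak q_\phi=\mathfrak h\oplus\sum_{\beta\in\mathcal Q_\phi}\mathfrak g_\beta .$$ Let $\phi\subseteq\mathcal B$ and suppose that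 there is a $\mathfrak g^\sigma$-equivariant CR algebra homomorphism of $(\mathfrak g^\sigma,\mathfrak q_\phi)$ onto a CR algebra $(\mathfrak g^\sigma,\mathfrak q')$. Then $(\mathfrak g^\sigma,\mathfrak q')$ is parabolic, and $\mathfrak q'=\mathfrak q_\psi$ for a subset $\psi\subseteq\phi$. For such a $\psi$, the fibration defined by the homomorphism is CR if and only if $$\mathcal Q^n_\phi\cap\sigma(\mathcal Q^n_\psi)\subseteq\mathcal Q^n_\psi .$$ -/

import Mathlib

open scoped TensorProduct

noncomputable section
namespace CRAlg

/-! ### Complexification and conjugation -/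

/-- The complexification `ℂ ⊗ L` of a real Lie algebra `L`. -/
abbrev Cx (L : Type*) [LieRing L] [LieAlgebra ℝ L] : Type _ := ℂ ⊗[ℝ] L

section Complexification

variable {L L' : Type*} [LieRing L] [LieAlgebra ℝ L] [LieRing L'] [LieAlgebra ℝ L']

/-- The anti-linear involution `σ` of `ℂ ⊗ L` that fixes `L`, i.e. `σ (a ⊗ x) = conj a ⊗ x`. -/
def conj : Cx L →ₛₗ[starRingEnd ℂ] Cx L where
  toFun := TensorProduct.map Complex.conjAe.toLinearMap (LinearMap.id : L →ₗ[ℝ] L)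
  map_add' := map_add _
  map_smul' c z := by
    induction z using TensorProduct.induction_on with
    | zero => simp
    | tmul a x => simp [TensorProduct.smul_tmul']
    | add u v hu hv => rw [smul_add, map_add, hu, hv, map_add, smul_add]

@[simp] lemma conj_tmul (a : ℂ) (x : L) :
    conj (a ⊗ₜ[ℝ] x : Cx L) = (starRingEnd ℂ a) ⊗ₜ[ℝ] x := rfl

/-- Every element of `ℂ ⊗ L` has the form `x + i y` with `x`, `y` in `L`. -/
lemma exists_re_im (z : Cx L) :
    ∃ x y : L, z = (1 : ℂ) ⊗ₜ[ℝ] x + Complex.I ⊗ₜ[ℝ] y := by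
  induction z using TensorProduct.induction_on with
  | zero => exact ⟨0, 0, by simp⟩
  | tmul a x =>
    refine ⟨a.re • x, a.im • x, ?_⟩
    rw [← TensorProduct.smul_tmul, ← TensorProduct.smul_tmul, ← TensorProduct.add_tmul]
    congr 1
    apply Complex.ext <;> simp
  | add u v hu hv =>
    obtain ⟨x, y, rfl⟩ := hu
    obtain ⟨x', y', rfl⟩ := hv
    exact ⟨x + x', y + y', by simp only [TensorProduct.tmul_add]; abel⟩

/-- Real and imaginary parts are unique. -/
lemma re_im_ext {x y x' y' : L}
    (h : (1 : ℂ) ⊗ₜ[ℝ] x + Complex.I ⊗ₜ[ℝ] y = (1 : ℂ) ⊗ₜ[ℝ] x' + Complex.I ⊗ₜ[ℝ] y') :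
    x = x' ∧ y = y' := by
  have hre := congrArg ((TensorProduct.lid ℝ L).toLinearMap ∘ₗ TensorProduct.map Complex.reLm LinearMap.id) h
  have him := congrArg ((TensorProduct.lid ℝ L).toLinearMap ∘ₗ TensorProduct.map Complex.imLm LinearMap.id) h
  constructor
  · simpa using hre
  · simpa using him

/-- The complexification of a semisimple real Lie algebra has nondegenerate Killing form. -/
instance isKilling_cx [Module.Finite ℝ L] [LieAlgebra.IsSemisimple ℝ L] :
    LieAlgebra.IsKilling ℂ (Cx L) where
  killingCompl_top_eq_bot := by
    rw [LieSubmodule.eq_bot_iff]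
    intro z hz
    rw [LieIdeal.mem_killingCompl] at hz
    obtain ⟨x, y, rfl⟩ := exists_re_im z
    have key : ∀ w : L, killingForm ℝ L x w = 0 ∧ killingForm ℝ L y w = 0 := by
      intro w
      have h := hz (1 ⊗ₜ[ℝ] w) (LieSubmodule.mem_top _)
      rw [LieModule.traceForm_comm] at h
      rw [LieModule.traceForm_baseChange] at h
      simp only [map_add, LinearMap.add_apply, LinearMap.BilinForm.baseChange_tmul] at h
      rw [Complex.ext_iff] at h
      simpa using h
    have nd := LieAlgebra.IsKilling.killingForm_nondegenerate ℝ L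
    have hx : x = 0 := nd.1 x fun w => (key w).1
    have hy : y = 0 := nd.1 y fun w => (key w).2
    simp [hx, hy]

/-- The complexification `ℂ ⊗ h`, as a complex subalgebra of `ℂ ⊗ L`, of a real subalgebra `h`. -/
def complexify (h : LieSubalgebra ℝ L) : LieSubalgebra ℂ (Cx L) where
  toSubmodule := h.toSubmodule.baseChange ℂ
  lie_mem' {z w} hz hw := by
    change z ∈ h.toSubmodule.baseChange ℂ at hz
    change w ∈ h.toSubmodule.baseChange ℂ at hw
    change ⁅z, w⁆ ∈ h.toSubmodule.baseChange ℂ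
    rw [Submodule.baseChange_eq_span] at hz hw
    induction hz using Submodule.span_induction with
    | zero => simp
    | add a b _ _ ha hb => rw [add_lie]; exact add_mem ha hb
    | smul c a _ ha => rw [smul_lie]; exact Submodule.smul_mem _ c ha
    | mem a ha =>
      obtain ⟨x, hx, rfl⟩ := ha
      induction hw using Submodule.span_induction with
      | zero =>
        convert zero_mem (h.toSubmodule.baseChange ℂ)
        exact lie_zero (L := Cx L) (M := Cx L) _
      | add a b _ _ ha hb => rw [LieRing.lie_add]; exact add_mem ha hb
      | smul c a _ ha => rw [LieAlgebra.lie_smul]; exact Submodule.smul_mem _ c ha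
      | mem b hb =>
        obtain ⟨y, hy, rfl⟩ := hb
        simp only [TensorProduct.mk_apply, LieAlgebra.ExtendScalars.bracket_tmul]
        exact Submodule.tmul_mem_baseChange_of_mem _ (h.lie_mem hx hy)

lemma tmul_mem_complexify (h : LieSubalgebra ℝ L) (a : ℂ) {x : L} (hx : x ∈ h) :
    a ⊗ₜ[ℝ] x ∈ complexify h :=
  Submodule.tmul_mem_baseChange_of_mem _ hx

lemma mem_complexify_iff (h : LieSubalgebra ℝ L) (x y : L) :
    (1 : ℂ) ⊗ₜ[ℝ] x + Complex.I ⊗ₜ[ℝ] y ∈ complexify h ↔ x ∈ h ∧ y ∈ h := by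
  constructor
  · intro hz
    have : ∀ z ∈ complexify h, ∃ x ∈ h, ∃ y ∈ h,
        z = (1 : ℂ) ⊗ₜ[ℝ] x + Complex.I ⊗ₜ[ℝ] y := by
      intro z hz
      change z ∈ h.toSubmodule.baseChange ℂ at hz
      obtain ⟨u, rfl⟩ := hz
      obtain ⟨x, y, rfl⟩ := exists_re_im (L := h) u
      exact ⟨x, x.2, y, y.2, by simp⟩
    obtain ⟨x', hx', y', hy', e⟩ := this _ hz
    obtain ⟨rfl, rfl⟩ := re_im_ext e
    exact ⟨hx', hy'⟩
  · rintro ⟨hx, hy⟩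
    exact add_mem (tmul_mem_complexify h _ hx) (tmul_mem_complexify h _ hy)

lemma conj_mem_complexify (h : LieSubalgebra ℝ L) {z : Cx L} (hz : z ∈ complexify h) :
    conj z ∈ complexify h := by
  obtain ⟨x, y, rfl⟩ := exists_re_im z
  rw [mem_complexify_iff] at hz
  rw [map_add, conj_tmul, conj_tmul]
  exact add_mem (tmul_mem_complexify h _ hz.1) (tmul_mem_complexify h _ hz.2)

/-- The complexification of a Cartan subalgebra is a Cartan subalgebra. -/
instance isCartanSubalgebra_complexify (h : LieSubalgebra ℝ L) [h.IsCartanSubalgebra] :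
    (complexify h).IsCartanSubalgebra where
  nilpotent := by
    let f : (ℂ ⊗[ℝ] h) →ₗ⁅ℂ⁆ complexify h :=
      { (LinearMap.codRestrict (complexify h).toSubmodule
          (h.toSubmodule.subtype.baseChange ℂ) (by
            intro z
            obtain ⟨x, y, rfl⟩ := exists_re_im (L := h) z
            simpa using (mem_complexify_iff h x y).2 ⟨x.2, y.2⟩)) with
        map_lie' := by
          intro z w
          obtain ⟨x, y, rfl⟩ := exists_re_im (L := h) z
          obtain ⟨x', y', rfl⟩ := exists_re_im (L := h) w
          apply Subtype.ext
          simp [LieAlgebra.ExtendScalars.bracket_tmul] }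
    have hf : Function.Surjective f := by
      rintro ⟨z, hz⟩
      obtain ⟨x, y, rfl⟩ := exists_re_im z
      obtain ⟨hx, hy⟩ := (mem_complexify_iff h x y).1 hz
      exact ⟨1 ⊗ₜ ⟨x, hx⟩ + Complex.I ⊗ₜ ⟨y, hy⟩, Subtype.ext rfl⟩
    exact Function.Surjective.lieAlgebra_isNilpotent hf
  self_normalizing := by
    refine le_antisymm ?_ (LieSubalgebra.le_normalizer _)
    intro z hz
    rw [LieSubalgebra.mem_normalizer_iff] at hz
    obtain ⟨x, y, rfl⟩ := exists_re_im z
    have key : ∀ w ∈ h, ⁅x, w⁆ ∈ h ∧ ⁅y, w⁆ ∈ h := by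
      intro w hw
      have := hz _ (tmul_mem_complexify h 1 hw)
      rw [add_lie, LieAlgebra.ExtendScalars.bracket_tmul, LieAlgebra.ExtendScalars.bracket_tmul,
        mul_one, mul_one, mem_complexify_iff] at this
      exact this
    rw [mem_complexify_iff]
    have hn : ∀ u : L, (∀ w ∈ h, ⁅u, w⁆ ∈ h) → u ∈ h := by
      intro u hu
      rw [← LieSubalgebra.IsCartanSubalgebra.self_normalizing (H := h),
        LieSubalgebra.mem_normalizer_iff]
      exact hu
    exact ⟨hn x fun w hw => (key w hw).1, hn y fun w hw => (key w hw).2⟩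

end Complexification

/-! ### Parabolic subalgebras -/

section Parabolic

variable {G : Type*} [LieRing G] [LieAlgebra ℂ G]

/-- A Borel subalgebra: a maximal solvable subalgebra. -/
def IsBorel (b : LieSubalgebra ℂ G) : Prop :=
  Maximal (fun s : LieSubalgebra ℂ G => LieAlgebra.IsSolvable s) b

/-- A parabolic subalgebra: one that contains a Borel subalgebra. -/
def IsParabolic (q : LieSubalgebra ℂ G) : Prop :=
  ∃ b : LieSubalgebra ℂ G, IsBorel b ∧ b ≤ q

variable [FiniteDimensional ℂ G] [LieAlgebra.IsKilling ℂ G]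
  {H : LieSubalgebra ℂ G} [H.IsCartanSubalgebra]

open LieAlgebra LieAlgebra.IsKilling Module

/-- The set of simple roots `𝓑` of a base (equivalently, of a Weyl chamber). -/
def simpleRoots (B : (rootSystem H).Base) : Set (Dual ℂ H) :=
  (rootSystem H).root '' B.support

/-- The parabolic set `𝓠_φ`: the roots `β = ∑ n_α α` (sum over the simple roots, with integral
coefficients) such that `n_α ≥ 0` for all `α ∈ φ`. -/
def parabolicSet (B : (rootSystem H).Base) (φ : Set (Dual ℂ H)) : Set (Dual ℂ H) :=
  {β | β ∈ Set.range (rootSystem H).root ∧ ∃ n : H.root → ℤ,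
    β = ∑ i ∈ B.support, n i • (rootSystem H).root i ∧
    ∀ i ∈ B.support, (rootSystem H).root i ∈ φ → 0 ≤ n i}

/-- The set `𝓠ⁿ_φ` of the roots `β ∈ 𝓠_φ` with `-β ∉ 𝓠_φ`. -/
def nilpotentSet (B : (rootSystem H).Base) (φ : Set (Dual ℂ H)) : Set (Dual ℂ H) :=
  {β | β ∈ parabolicSet B φ ∧ -β ∉ parabolicSet B φ}

lemma add_mem_parabolicSet (B : (rootSystem H).Base) (φ : Set (Dual ℂ H)) {α β : Dual ℂ H}
    (hα : α ∈ parabolicSet B φ) (hβ : β ∈ parabolicSet B φ)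
    (hr : α + β ∈ Set.range (rootSystem H).root) : α + β ∈ parabolicSet B φ := by
  obtain ⟨-, n, hn, hn0⟩ := hα
  obtain ⟨-, m, hm, hm0⟩ := hβ
  refine ⟨hr, fun i => n i + m i, ?_, fun i hi hφ => add_nonneg (hn0 i hi hφ) (hm0 i hi hφ)⟩
  rw [hn, hm, ← Finset.sum_add_distrib]
  simp only [add_smul]

/-- A nonzero linear form with nonzero root space is a root. -/
lemma mem_range_root {χ : Dual ℂ H} (h0 : χ ≠ 0) {z : G} (hz : z ∈ rootSpace H χ) (hz0 : z ≠ 0) :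
    χ ∈ Set.range (rootSystem H).root := by
  let w : LieModule.Weight ℂ H G := ⟨χ, fun h => hz0 (by simpa [h] using hz)⟩
  have hw : w ∈ H.root := by
    simp only [LieSubalgebra.root, Finset.mem_filter, Finset.mem_univ, true_and]
    intro h
    apply h0
    ext x
    exact congrFun h x
  refine ⟨⟨w, hw⟩, ?_⟩
  ext x
  rfl

/-- The subalgebra `𝔮_φ = 𝔥 ⊕ ∑_{β ∈ 𝓠_φ} 𝔤_β`. -/
def parabolicSubalgebra (B : (rootSystem H).Base) (φ : Set (Dual ℂ H)) : LieSubalgebra ℂ G where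
  toSubmodule := H.toSubmodule ⊔ ⨆ β ∈ parabolicSet B φ, (rootSpace H β).toSubmodule
  lie_mem' {z w} hz hw := by
    set S := H.toSubmodule ⊔ ⨆ β ∈ parabolicSet B φ, (rootSpace H β).toSubmodule with hS
    change z ∈ S at hz
    change w ∈ S at hw
    change ⁅z, w⁆ ∈ S
    let T : Set (Dual ℂ H) := insert 0 (parabolicSet B φ)
    have h0 : (rootSpace H (0 : H → ℂ)).toSubmodule = H.toSubmodule := by
      rw [rootSpace_zero_eq]; rfl
    have hST : S = ⨆ β ∈ T, (rootSpace H β).toSubmodule := by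
      rw [iSup_insert, hS, ← h0]
      rfl
    have hle : ∀ β ∈ T, ∀ u ∈ rootSpace H β, u ∈ S := by
      intro β hβ u hu
      rw [hST]
      exact (le_biSup (fun β : Dual ℂ H => (rootSpace H β).toSubmodule) hβ) hu
    have key : ∀ α ∈ T, ∀ β ∈ T, ∀ u ∈ rootSpace H α, ∀ v ∈ rootSpace H β, ⁅u, v⁆ ∈ S := by
      intro α hα β hβ u hu v hv
      have huv : ⁅u, v⁆ ∈ rootSpace H ((α + β : Dual ℂ H) : H → ℂ) :=
        lie_mem_genWeightSpace_of_mem_genWeightSpace hu hv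
      by_cases hz0 : ⁅u, v⁆ = 0
      · rw [hz0]; exact zero_mem _
      refine hle (α + β) ?_ _ huv
      by_cases hab : α + β = 0
      · exact Or.inl hab
      have hr := mem_range_root hab huv hz0
      rcases hα with rfl | hα
      · simpa [T] using hβ
      rcases hβ with rfl | hβ
      · simpa [T] using Or.inr hα
      exact Or.inr (add_mem_parabolicSet B φ hα hβ hr)
    rw [hST] at hz hw
    induction hz using Submodule.iSup_induction' with
    | zero => rw [zero_lie]; exact zero_mem _
    | add a b _ _ ha hb => rw [add_lie]; exact add_mem ha hb
    | mem α u hu =>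
      by_cases hα : α ∈ T
      swap
      · simp only [hα, iSup_false, Submodule.mem_bot] at hu
        rw [hu, zero_lie]; exact zero_mem _
      simp only [hα, iSup_true] at hu
      induction hw using Submodule.iSup_induction' with
      | zero => rw [lie_zero]; exact zero_mem _
      | add a b _ _ ha hb => rw [lie_add]; exact add_mem ha hb
      | mem β v hv =>
        by_cases hβ : β ∈ T
        swap
        · simp only [hβ, iSup_false, Submodule.mem_bot] at hv
          rw [hv, lie_zero]; exact zero_mem _
        simp only [hβ, iSup_true] at hv
        exact key α hα β hβ u hu v hv

end Parabolic

/-! ### CR algebras -/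

section CRAlgebras

variable {L L' : Type*} [LieRing L] [LieAlgebra ℝ L] [LieRing L'] [LieAlgebra ℝ L']

/-- The isotropy subalgebra `𝔮 ∩ L` of a complex subalgebra `𝔮` of `ℂ ⊗ L`. -/
def isotropy (q : LieSubalgebra ℂ (Cx L)) : Submodule ℝ L :=
  (q.toSubmodule.restrictScalars ℝ).comap (TensorProduct.mk ℝ ℂ L 1)

variable (L) in
/-- A CR algebra `(L, 𝔮)` with underlying real Lie algebra `L`. -/
structure CRAlgebra where
  /-- The complex subalgebra `𝔮` of `ℂ ⊗ L`. -/
  q : LieSubalgebra ℂ (Cx L)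
  finite : FiniteDimensional ℝ (L ⧸ isotropy q)

/-- The complex-linear extension `ℂ ⊗ L → ℂ ⊗ L'` of a homomorphism `f : L → L'`. -/
def cxMap (f : L →ₗ⁅ℝ⁆ L') : Cx L →ₗ[ℂ] Cx L' :=
  (f : L →ₗ[ℝ] L').baseChange ℂ

lemma cxMap_conj (f : L →ₗ⁅ℝ⁆ L') (z : Cx L) : cxMap f (conj z) = conj (cxMap f z) := by
  obtain ⟨x, y, rfl⟩ := exists_re_im z
  simp [cxMap]

namespace CRAlgebra

/-- A homomorphism `(L, 𝔮) → (L', 𝔮')` of CR algebras: a homomorphism `L → L'` of real Lie algebras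
whose complexification maps `𝔮` into `𝔮'`. -/
structure Hom (A : CRAlgebra L) (A' : CRAlgebra L') where
  toLieHom : L →ₗ⁅ℝ⁆ L'
  map_mem : ∀ z ∈ A.q, cxMap toLieHom z ∈ A'.q

/-- The complexified isotropy `𝔮 ∩ σ(𝔮)`. -/
def cxIsotropy (A : CRAlgebra L) : Submodule ℂ (Cx L) :=
  A.q.toSubmodule ⊓ A.q.toSubmodule.map conj

/-- The complexified tangent space `(ℂ ⊗ L) / (𝔮 ∩ σ(𝔮))` at the base point. -/
abbrev CxTangent (A : CRAlgebra L) : Type _ := Cx L ⧸ A.cxIsotropy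

/-- The subspace `T^{0,1}` of the complexified tangent space: the image of `𝔮`. -/
def tangent01 (A : CRAlgebra L) : Submodule ℂ A.CxTangent :=
  A.q.toSubmodule.map A.cxIsotropy.mkQ

namespace Hom

variable {A : CRAlgebra L} {A' : CRAlgebra L'}

/-- The complexified differential at the base point of the map of homogeneous spaces defined by a
homomorphism of CR algebras. -/
def differential (F : Hom A A') : A.CxTangent →ₗ[ℂ] A'.CxTangent :=
  Submodule.mapQ A.cxIsotropy A'.cxIsotropy (cxMap F.toLieHom) (by
    rintro z ⟨hz, w, hw, rfl⟩
    exact ⟨F.map_mem _ hz, _, F.map_mem w hw, (cxMap_conj F.toLieHom w).symm⟩)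

/-- The homomorphism `F` is onto: the underlying map of real Lie algebras is surjective. -/
def IsOnto (F : Hom A A') : Prop := Function.Surjective F.toLieHom

/-- The fibration defined by `F` is CR: its differential maps `T^{0,1}` onto `T^{0,1}`. -/
def IsCRFibration (F : Hom A A') : Prop :=
  A.tangent01.map F.differential = A'.tangent01

/-- Equivariance, for the adjoint action, of a homomorphism between CR algebras with the same
underlying real Lie algebra `L`. -/
def IsEquivariant {A A' : CRAlgebra L} (F : Hom A A') : Prop :=
  ∀ x y : L, F.toLieHom ⁅x, y⁆ = ⁅x, F.toLieHom y⁆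

end Hom

end CRAlgebra

variable [Module.Finite ℝ L] [LieAlgebra.IsSemisimple ℝ L]
  {h : LieSubalgebra ℝ L} [h.IsCartanSubalgebra]

open LieAlgebra.IsKilling Module

/-- The action of `σ` on linear forms on the complexification of `h`:
`σ(α)(X) = conj (α (σ X))`. -/
def conjDual (α : Dual ℂ (complexify h)) : Dual ℂ (complexify h) where
  toFun X := starRingEnd ℂ (α ⟨conj X, conj_mem_complexify h X.2⟩)
  map_add' X Y := by
    rw [← map_add, ← map_add]
    congr 2
    exact Subtype.ext (map_add conj (X : Cx L) (Y : Cx L))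
  map_smul' c X := by
    have e : (⟨conj ((c • X : complexify h) : Cx L), conj_mem_complexify h (c • X).2⟩ :
        complexify h) = starRingEnd ℂ c • ⟨conj X, conj_mem_complexify h X.2⟩ :=
      Subtype.ext (conj.map_smulₛₗ c (X : Cx L))
    rw [e, map_smul, smul_eq_mul, map_mul, Complex.conj_conj]
    rfl

/-- The CR algebra `(L, 𝔮_φ)`. -/
def parabolicCRAlgebra (B : (rootSystem (complexify h)).Base) (φ : Set (Dual ℂ (complexify h))) :
    CRAlgebra L where
  q := parabolicSubalgebra B φ
  finite := inferInstance

end CRAlgebras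

end CRAlg

end

/-! Equivariance and multiplicativity give `[f x, f y] = f [x, y] = [x, f y]`, so `f x - x`
centralizes the image of `f`, which is all of `L`. The center of a semisimple algebra is zero, hence
`f = id` (`toLieHom_eq_self`). Everything then concerns an inclusion `𝔮_φ ≤ 𝔮'` of subalgebras
containing `𝔥`.

Such a subalgebra is `𝔥` plus root spaces (`toSubmodule_eq_rootSum`), and its roots are closed under
addition (`rootSpace_add_le`). Since `𝔮'` contains the positive root spaces, it is determined by the
negatives of simple roots occurring in it; this yields `ψ` (`exists_eq_parabolicSubalgebra`). It is
parabolic because the subalgebra of the positive roots is Borel (`isBorel_baseBorel`).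

For `f = id` the fibration is CR iff `𝔮_ψ ≤ 𝔮_φ + 𝔮_ψ ∩ σ(𝔮_ψ)` (`isCRFibration_iff`). Read on
roots, every `β ∈ 𝓠_ψ` satisfies `β ∈ 𝓠_φ` or `σ(β) ∈ 𝓠_ψ`. The contrapositive for `-β` is the
stated inclusion, because `-β ∉ 𝓠` means `β ∈ 𝓠ⁿ`. -/

noncomputable section
namespace CRAlg

/-! ### Subalgebras containing a Cartan subalgebra, as sums of root spaces. -/

section RootDecomposition

variable {G : Type*} [LieRing G] [LieAlgebra ℂ G] {H : LieSubalgebra ℂ G} [H.IsCartanSubalgebra]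

open LieAlgebra LieAlgebra.IsKilling Module

/-- The linear forms whose root space lies in a given subspace. -/
def formsOf (N : Submodule ℂ G) : Set (Dual ℂ H) :=
  {χ | (rootSpace H χ).toSubmodule ≤ N}

/-- The sum of the root spaces of a set of linear forms. -/
def rootSum (T : Set (Dual ℂ H)) : Submodule ℂ G :=
  ⨆ χ ∈ T, (rootSpace H χ).toSubmodule

lemma rootSpace_le_rootSum {T : Set (Dual ℂ H)} {χ : Dual ℂ H} (h : χ ∈ T) :
    (rootSpace H χ).toSubmodule ≤ rootSum T :=
  le_biSup (fun χ : Dual ℂ H => (rootSpace H χ).toSubmodule) h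

lemma rootSum_le {T : Set (Dual ℂ H)} {N : Submodule ℂ G}
    (h : ∀ χ ∈ T, (rootSpace H χ).toSubmodule ≤ N) : rootSum T ≤ N :=
  iSup₂_le h

variable [FiniteDimensional ℂ G]

lemma rootSpace_zero_toSubmodule :
    (rootSpace H ((0 : Dual ℂ H) : H → ℂ)).toSubmodule = H.toSubmodule := by
  change (rootSpace H (0 : H → ℂ)).toSubmodule = H.toSubmodule
  rw [rootSpace_zero_eq]; rfl

variable [LieAlgebra.IsKilling ℂ G]

lemma rootSpace_root_ne_bot (i : H.root) :
    (rootSpace H ((rootSystem H).root i)).toSubmodule ≠ ⊥ := by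
  have := i.1.genWeightSpace_ne_bot
  simpa using! this

lemma rootSpace_le_of_mem (i : H.root) {N : Submodule ℂ G} {x : G}
    (hx : x ∈ rootSpace H ((rootSystem H).root i)) (hx0 : x ≠ 0) (hN : x ∈ N) :
    (rootSpace H ((rootSystem H).root i)).toSubmodule ≤ N := by
  have h1 : finrank ℂ (rootSpace H ((rootSystem H).root i)) = 1 :=
    finrank_rootSpace_eq_one i.1 (LieSubalgebra.isNonZero_coe_root i)
  intro y hy
  obtain ⟨c, hc⟩ := (finrank_eq_one_iff_of_nonzero'
    (⟨x, hx⟩ : rootSpace H ((rootSystem H).root i))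
    (fun h => hx0 (congrArg Subtype.val h))).1 h1 ⟨y, hy⟩
  have : c • x = y := congrArg Subtype.val hc
  exact this ▸ N.smul_mem c hN

/-- A subalgebra that contains the Cartan subalgebra is a sum of root spaces. -/
lemma toSubmodule_eq_rootSum {q : LieSubalgebra ℂ G} (hq : H ≤ q) :
    q.toSubmodule = rootSum (H := H) (formsOf q.toSubmodule) := by
  refine le_antisymm ?_ (rootSum_le fun _ h => h)
  -- As `H ≤ q`, the subspace `q` is stable under `H`, hence the sum of its intersections with the
  -- weight spaces. Root spaces are lines, so a nonzero intersection is the whole root space.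
  let N : LieSubmodule ℂ H G :=
    { q.toSubmodule with lie_mem := fun {x m} hm => q.lie_mem (hq x.2) hm }
  have key : N = ⨆ χ : LieModule.Weight ℂ H G, N ⊓ LieModule.genWeightSpace G χ :=
    LieModule.eq_iSup_inf_genWeightSpace (N := N)
  have key' := congrArg LieSubmodule.toSubmodule key
  rw [LieSubmodule.iSup_toSubmodule] at key'
  change N.toSubmodule ≤ _
  rw [key']
  refine iSup_le fun χ => ?_
  rintro x ⟨hxN, hx⟩
  by_cases hχ : χ.IsZero
  · have hx' : x ∈ (rootSpace H ((0 : Dual ℂ H) : H → ℂ)).toSubmodule := by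
      have : (χ : H → ℂ) = ((0 : Dual ℂ H) : H → ℂ) := by rw [hχ.eq]; rfl
      rw [← this]; exact hx
    refine rootSpace_le_rootSum ?_ hx'
    change (rootSpace H ((0 : Dual ℂ H) : H → ℂ)).toSubmodule ≤ q.toSubmodule
    rw [rootSpace_zero_toSubmodule]; exact hq
  · by_cases hx0 : x = 0
    · rw [hx0]; exact zero_mem _
    let i : H.root := ⟨χ, by simpa [LieSubalgebra.root] using hχ⟩
    exact rootSpace_le_rootSum (χ := (rootSystem H).root i)
      (rootSpace_le_of_mem i hx hx0 hxN) hx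

/-- Root spaces are linearly independent. -/
lemma mem_of_rootSpace_le_rootSum (i : H.root) {T : Set (Dual ℂ H)}
    (h : (rootSpace H ((rootSystem H).root i)).toSubmodule ≤ rootSum T) :
    (rootSystem H).root i ∈ T := by
  by_contra hi
  have hind : iSupIndep fun χ : Dual ℂ H => (rootSpace H χ).toSubmodule :=
    (LieSubmodule.iSupIndep_toSubmodule.2 (LieModule.iSupIndep_genWeightSpace ℂ H G)).comp
      (f := fun χ : Dual ℂ H => (χ : H → ℂ)) DFunLike.coe_injective
  exact rootSpace_root_ne_bot i ((hind.disjoint_biSup hi).eq_bot_of_le h)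

/-- A line in a sum need not lie in a summand; here it does, because both summands are sums of
members of one independent family. -/
lemma rootSpace_le_sup_iff (i : H.root) {q r : LieSubalgebra ℂ G} (hq : H ≤ q) (hr : H ≤ r) :
    (rootSpace H ((rootSystem H).root i)).toSubmodule ≤ q.toSubmodule ⊔ r.toSubmodule ↔
      (rootSpace H ((rootSystem H).root i)).toSubmodule ≤ q.toSubmodule ∨
      (rootSpace H ((rootSystem H).root i)).toSubmodule ≤ r.toSubmodule := by
  refine ⟨fun h => ?_, fun h => h.elim le_sup_of_le_left le_sup_of_le_right⟩
  rw [toSubmodule_eq_rootSum hq, toSubmodule_eq_rootSum hr, rootSum, rootSum,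
    ← iSup_union] at h
  exact mem_of_rootSpace_le_rootSum i h

/-- A subalgebra that contains the Cartan subalgebra is determined by its roots. -/
lemma toSubmodule_le_of_root_le {q : LieSubalgebra ℂ G} {N : Submodule ℂ G} (hq : H ≤ q)
    (hN : H.toSubmodule ≤ N)
    (h : ∀ i : H.root, (rootSpace H ((rootSystem H).root i)).toSubmodule ≤ q.toSubmodule →
      (rootSpace H ((rootSystem H).root i)).toSubmodule ≤ N) :
    q.toSubmodule ≤ N := by
  rw [toSubmodule_eq_rootSum hq]
  refine rootSum_le fun χ hχ => ?_
  by_cases h0 : χ = 0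
  · rw [h0, rootSpace_zero_toSubmodule]; exact hN
  intro x hx
  by_cases hx0 : x = 0
  · rw [hx0]; exact zero_mem _
  obtain ⟨i, rfl⟩ := mem_range_root h0 hx hx0
  exact h i hχ hx

lemma le_parabolicSubalgebra (B : (rootSystem H).Base) (φ : Set (Dual ℂ H)) :
    H ≤ parabolicSubalgebra B φ :=
  fun _ hx => (le_sup_left : H.toSubmodule ≤ (parabolicSubalgebra B φ).toSubmodule) hx

lemma parabolicSubalgebra_toSubmodule (B : (rootSystem H).Base) (φ : Set (Dual ℂ H)) :
    (parabolicSubalgebra B φ).toSubmodule = rootSum (insert 0 (parabolicSet B φ)) := by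
  rw [rootSum, iSup_insert, rootSpace_zero_toSubmodule]; rfl

lemma rootSpace_le_parabolicSubalgebra_iff (B : (rootSystem H).Base) (φ : Set (Dual ℂ H))
    (i : H.root) :
    (rootSpace H ((rootSystem H).root i)).toSubmodule ≤ (parabolicSubalgebra B φ).toSubmodule ↔
      (rootSystem H).root i ∈ parabolicSet B φ := by
  rw [parabolicSubalgebra_toSubmodule]
  refine ⟨fun h => ?_, fun h => rootSpace_le_rootSum (Or.inr h)⟩
  exact (mem_of_rootSpace_le_rootSum i h).resolve_left ((rootSystem H).ne_zero i)

/-- If `α`, `β` and `α + β` are roots then `[𝔤_α, 𝔤_β]` is nonzero. -/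
lemma exists_lie_ne_zero {i j k : H.root}
    (hk : (rootSystem H).root k = (rootSystem H).root i + (rootSystem H).root j) :
    ∃ e ∈ rootSpace H ((rootSystem H).root i), ∃ v ∈ rootSpace H ((rootSystem H).root j),
      ⁅e, v⁆ ≠ 0 := by
  have hi := LieSubalgebra.isNonZero_coe_root i
  set α : LieModule.Weight ℂ H G := i.1
  set β : LieModule.Weight ℂ H G := j.1
  have hfun : (k.1 : H → ℂ) = (1 : ℤ) • (α : H → ℂ) + β := by
    have := congrArg (fun f : Dual ℂ H => (f : H → ℂ)) hk
    simpa using! this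
  have ht : (1 : ℤ) ≤ LieModule.chainTopCoeff α β :=
    ((rootSpace_zsmul_add_ne_bot_iff α β hi 1).1 (hfun ▸ k.1.genWeightSpace_ne_bot)).1
  obtain ⟨t, ht'⟩ : ∃ t, LieModule.chainTopCoeff α β = t + 1 :=
    ⟨LieModule.chainTopCoeff α β - 1, by omega⟩
  have htm : t + 1 ≤ chainLength α β := ht' ▸ chainTopCoeff_le_chainLength α β
  obtain ⟨x, hx, hx0⟩ := (LieModule.chainTop (α : H → ℂ) β).exists_ne_zero
  obtain ⟨h, e, f, isSl2, he, hf⟩ := exists_isSl2Triple_of_weight_isNonZero hi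
  obtain rfl := isSl2.h_eq_coroot hi he hf
  have prim : isSl2.HasPrimitiveVectorWith x (chainLength α β : ℂ) :=
    { ne_zero := hx0
      lie_h := (chainLength_smul _ _ hx).symm
      lie_e := by
        have := lie_mem_genWeightSpace_of_mem_genWeightSpace he hx
        rwa [LieModule.genWeightSpace_add_chainTop _ _ hi] at this }
  -- `x` is a highest weight vector at the top `β + (t + 1)α` of the `α`-string, so `f ^ (t + 1)`
  -- brings it down to `𝔤_β`. By `𝔰𝔩₂` theory `e` sends the result to `(t + 1)(n - t) f ^ t x` with
  -- `n` the chain length, nonzero since `t < n`.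
  refine ⟨e, he, ((LieModule.toEnd ℂ G G f) ^ (t + 1)) x, ?_, ?_⟩
  · have := toEnd_pow_apply_mem hf hx (t + 1)
    convert! this using 2
    rw [LieModule.coe_chainTop', ht']
    change (β : H → ℂ) = _
    simp
  · rw [prim.lie_e_pow_succ_toEnd_f t]
    refine smul_ne_zero (mul_ne_zero (by exact_mod_cast Nat.succ_ne_zero t) ?_) ?_
    · rw [sub_ne_zero]; exact_mod_cast (by omega : chainLength α β ≠ t)
    · exact prim.pow_toEnd_f_ne_zero_of_eq_nat rfl (by omega)

/-- The roots of a subalgebra are closed under addition. -/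
lemma rootSpace_add_le {q : LieSubalgebra ℂ G} {i j k : H.root}
    (hk : (rootSystem H).root k = (rootSystem H).root i + (rootSystem H).root j)
    (hi : (rootSpace H ((rootSystem H).root i)).toSubmodule ≤ q.toSubmodule)
    (hj : (rootSpace H ((rootSystem H).root j)).toSubmodule ≤ q.toSubmodule) :
    (rootSpace H ((rootSystem H).root k)).toSubmodule ≤ q.toSubmodule := by
  obtain ⟨e, he, v, hv, hev⟩ := exists_lie_ne_zero hk
  refine rootSpace_le_of_mem k ?_ hev (q.lie_mem (hi he) (hj hv))
  rw [hk]
  exact lie_mem_genWeightSpace_of_mem_genWeightSpace he hv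

end RootDecomposition

/-! ### Parabolic sets of roots and the subalgebras above `𝔮_φ`. -/

section ParabolicSets

variable {G : Type*} [LieRing G] [LieAlgebra ℂ G]
  [FiniteDimensional ℂ G] [LieAlgebra.IsKilling ℂ G]
  {H : LieSubalgebra ℂ G} [H.IsCartanSubalgebra]

open LieAlgebra LieAlgebra.IsKilling Module

/-- The coefficients of a root with respect to a base are unique. -/
lemma base_coeff_unique (B : (rootSystem H).Base) {n m : H.root → ℤ}
    (h : ∑ i ∈ B.support, n i • (rootSystem H).root i =
      ∑ i ∈ B.support, m i • (rootSystem H).root i) : ∀ i ∈ B.support, n i = m i := by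
  intro i hi
  rw [B.support.sum_subtype (p := (· ∈ B.support)) (by simp) (F := inferInstance),
    B.support.sum_subtype (p := (· ∈ B.support)) (by simp) (F := inferInstance)] at h
  exact Fintype.linearIndependent_iffₛ.mp (B.linearIndepOn_root.restrict_scalars' ℤ)
    (fun j => n j) (fun j => m j) h ⟨i, hi⟩

lemma mem_parabolicSet_iff (B : (rootSystem H).Base) (φ : Set (Dual ℂ H)) {i : H.root}
    {n : H.root → ℤ}
    (hn : (rootSystem H).root i = ∑ j ∈ B.support, n j • (rootSystem H).root j) :
    (rootSystem H).root i ∈ parabolicSet B φ ↔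
      ∀ j ∈ B.support, (rootSystem H).root j ∈ φ → 0 ≤ n j := by
  refine ⟨?_, fun h => ⟨⟨i, rfl⟩, n, hn, h⟩⟩
  rintro ⟨-, m, hm, hm0⟩ j hj hφ
  rw [base_coeff_unique B (hn.symm.trans hm) j hj]
  exact hm0 j hj hφ

lemma parabolicSet_antitone (B : (rootSystem H).Base) {φ ψ : Set (Dual ℂ H)} (h : ψ ⊆ φ) :
    parabolicSet B φ ⊆ parabolicSet B ψ := by
  rintro β ⟨hr, n, hn, hn0⟩
  exact ⟨hr, n, hn, fun i hi hψ => hn0 i hi (h hψ)⟩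

lemma exists_neg_root (i : H.root) :
    ∃ j, (rootSystem H).root j = -(rootSystem H).root i :=
  ⟨(rootSystem H).reflectionPerm i i, by
    rw [RootPairing.root_reflectionPerm, RootPairing.reflection_apply_self]⟩

/-- `IsPos` is governed by the height, the sum of the coefficients; as these all have one sign, the
sign of the sum decides. -/
lemma isPos_iff_forall_nonneg (B : (rootSystem H).Base) {i : H.root} {n : H.root → ℤ}
    (hn : (rootSystem H).root i = ∑ j ∈ B.support, n j • (rootSystem H).root j) :
    B.IsPos i ↔ ∀ j ∈ B.support, 0 ≤ n j := by
  constructor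
  · intro hi
    obtain ⟨f, -, hf | hf, hfn⟩ := B.exists_root_eq_sum_int i
    · intro j hj
      rw [base_coeff_unique B (hn.symm.trans hfn) j hj]
      exact hf.le j
    · rw [RootPairing.Base.isPos_iff, RootPairing.Base.height_eq_sum hfn] at hi
      exact absurd hi (not_lt.2 (Finset.sum_nonpos fun j _ => hf.le j))
  · intro h
    rw [RootPairing.Base.isPos_iff', RootPairing.Base.height_eq_sum hn]
    exact Finset.sum_nonneg h

lemma isPos_or_isPos_of_eq_neg (B : (rootSystem H).Base) {i j : H.root}
    (h : (rootSystem H).root j = -(rootSystem H).root i) : B.IsPos i ∨ B.IsPos j := by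
  obtain ⟨n, -, hn, e⟩ := B.exists_root_eq_sum_int i
  have e' : (rootSystem H).root j = ∑ k ∈ B.support, (-n) k • (rootSystem H).root k := by
    simp [h, e]
  rw [isPos_iff_forall_nonneg B e, isPos_iff_forall_nonneg B e']
  refine hn.imp (fun hn k _ => hn.le k) (fun hn k _ => ?_)
  simpa using hn.le k

lemma mem_parabolicSet_of_isPos {B : (rootSystem H).Base} {i : H.root} (hi : B.IsPos i)
    (φ : Set (Dual ℂ H)) : (rootSystem H).root i ∈ parabolicSet B φ := by
  obtain ⟨n, -, -, e⟩ := B.exists_root_eq_sum_int i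
  exact ⟨⟨i, rfl⟩, n, e, fun j hj _ => (isPos_iff_forall_nonneg B e).1 hi j hj⟩

lemma mem_parabolicSet_simpleRoots_iff (B : (rootSystem H).Base) (i : H.root) :
    (rootSystem H).root i ∈ parabolicSet B (simpleRoots B) ↔ B.IsPos i := by
  refine ⟨?_, fun h => mem_parabolicSet_of_isPos h _⟩
  rintro ⟨-, n, e, h⟩
  exact (isPos_iff_forall_nonneg B e).2 fun j hj => h j hj ⟨j, hj, rfl⟩

lemma mem_or_neg_mem_parabolicSet (B : (rootSystem H).Base) (φ : Set (Dual ℂ H))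
    {β : Dual ℂ H} (hβ : β ∈ Set.range (rootSystem H).root) :
    β ∈ parabolicSet B φ ∨ -β ∈ parabolicSet B φ := by
  obtain ⟨i, rfl⟩ := hβ
  obtain ⟨j, hj⟩ := exists_neg_root i
  rw [← hj]
  exact (isPos_or_isPos_of_eq_neg B hj).imp (mem_parabolicSet_of_isPos · φ)
    (mem_parabolicSet_of_isPos · φ)

/-- One of `β`, `-β` always lies in `𝓠_φ`, so `𝓠ⁿ_φ` is the complement of `-𝓠_φ` among the roots. -/
lemma mem_nilpotentSet_iff (B : (rootSystem H).Base) (φ : Set (Dual ℂ H))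
    {β : Dual ℂ H} (hβ : β ∈ Set.range (rootSystem H).root) :
    β ∈ nilpotentSet B φ ↔ -β ∉ parabolicSet B φ :=
  ⟨fun h => h.2, fun h => ⟨(mem_or_neg_mem_parabolicSet B φ hβ).resolve_right h, h⟩⟩

lemma neg_simple_mem_parabolicSet_iff (B : (rootSystem H).Base) (φ : Set (Dual ℂ H))
    {i : H.root} (hi : i ∈ B.support) :
    -(rootSystem H).root i ∈ parabolicSet B φ ↔ (rootSystem H).root i ∉ φ := by
  classical
  obtain ⟨j, hj⟩ := exists_neg_root i
  have e : (rootSystem H).root j =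
      ∑ k ∈ B.support, (if k = i then (-1 : ℤ) else 0) • (rootSystem H).root k := by
    simp [hj, ite_smul, hi]
  rw [← hj, mem_parabolicSet_iff B φ e]
  constructor
  · intro h hφ
    simpa using h i hi hφ
  · intro h k hk hkφ
    rw [if_neg]
    rintro rfl
    exact h hkφ

/-- A set of roots that is closed under addition and contains the positive roots is determined by
the negatives of simple roots that it contains. -/
lemma imp_of_forall_neg_simple (B : (rootSystem H).Base) {Q R : H.root → Prop}
    (hQ : ∀ i j k, (rootSystem H).root k = (rootSystem H).root i + (rootSystem H).root j →
      Q i → Q j → Q k)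
    (hR : ∀ i j k, (rootSystem H).root k = (rootSystem H).root i + (rootSystem H).root j →
      R i → R j → R k)
    (hQ' : ∀ i, B.IsPos i → Q i) (hR' : ∀ i, B.IsPos i → R i)
    (h : ∀ i ∈ B.support, ∀ j, (rootSystem H).root j = -(rootSystem H).root i → Q j → R j)
    (i : H.root) (hi : Q i) : R i := by
  obtain ⟨j, hj⟩ := exists_neg_root i
  rcases isPos_or_isPos_of_eq_neg B hj with hpos | hpos
  · exact hR' i hpos
  have hij : (rootSystem H).root i = -(rootSystem H).root j := by rw [hj, neg_neg]
  -- Induction on positive roots, adding a simple root each time. Positivity is carried along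
  -- because the inductive step applies `hQ'` to the smaller root.
  suffices B.IsPos j ∧ ∀ i, (rootSystem H).root i = -(rootSystem H).root j → Q i → R i from
    this.2 i hij hi
  refine hpos.induction_on_add (p := fun j => B.IsPos j ∧
    ∀ i, (rootSystem H).root i = -(rootSystem H).root j → Q i → R i) ?_ ?_
  · exact fun j hj => ⟨RootPairing.Base.isPos_of_mem_support hj, h j hj⟩
  · rintro j l k hk ⟨hjpos, ih⟩ hl
    have hlpos := RootPairing.Base.isPos_of_mem_support hl
    refine ⟨hjpos.add hlpos hk, fun i hik hi => ?_⟩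
    obtain ⟨j', hj'⟩ := exists_neg_root j
    obtain ⟨l', hl'⟩ := exists_neg_root l
    -- With `k = j + l`, adding the positive root `l` or `j` to `-k` puts `-j` and `-l` in `Q`. Both
    -- pass to `R`, and so does their sum `-k`.
    refine hR j' l' i (by rw [hik, hk, hj', hl', neg_add]) (ih j' hj' ?_) (h l hl l' hl' ?_)
    · exact hQ i l j' (by rw [hj', hik, hk]; abel) hi (hQ' l hlpos)
    · exact hQ i j l' (by rw [hl', hik, hk]; abel) hi (hQ' j hjpos)

/-- A subalgebra that contains `𝔮_φ` is `𝔮_ψ` for a subset `ψ` of `φ`. -/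
lemma exists_eq_parabolicSubalgebra (B : (rootSystem H).Base) {φ : Set (Dual ℂ H)}
    {q : LieSubalgebra ℂ G} (hq : parabolicSubalgebra B φ ≤ q) :
    ∃ ψ ⊆ φ, q = parabolicSubalgebra B ψ := by
  have hHq : H ≤ q := (le_parabolicSubalgebra B φ).trans hq
  let Q : H.root → Prop := fun i =>
    (rootSpace H ((rootSystem H).root i)).toSubmodule ≤ q.toSubmodule
  have hQφ : ∀ i, (rootSystem H).root i ∈ parabolicSet B φ → Q i := fun i hi =>
    ((rootSpace_le_parabolicSubalgebra_iff B φ i).2 hi).trans hq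
  have hQadd : ∀ i j k, (rootSystem H).root k = (rootSystem H).root i + (rootSystem H).root j →
      Q i → Q j → Q k := fun i j k hk hi hj => rootSpace_add_le hk hi hj
  have hQpos : ∀ i, B.IsPos i → Q i := fun i hi => hQφ i (mem_parabolicSet_of_isPos hi φ)
  -- Chosen so that `q` and `𝔮_ψ` contain the same negatives of simple roots. Restricting to `φ`
  -- loses nothing: for a simple `α ∉ φ`, the root `-α` already occurs in `𝔮_φ ≤ q`.
  let ψ : Set (Dual ℂ H) := {α ∈ φ | -α ∉ formsOf q.toSubmodule}
  have hψ : ψ ⊆ φ := fun α h => h.1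
  let R : H.root → Prop := fun i => (rootSystem H).root i ∈ parabolicSet B ψ
  have hRadd : ∀ i j k, (rootSystem H).root k = (rootSystem H).root i + (rootSystem H).root j →
      R i → R j → R k := by
    intro i j k hk hi hj
    change (rootSystem H).root k ∈ _
    rw [hk]
    exact add_mem_parabolicSet B ψ hi hj ⟨k, hk⟩
  have hRpos : ∀ i, B.IsPos i → R i := fun i hi => mem_parabolicSet_of_isPos hi ψ
  have hQR : ∀ i, Q i → R i := by
    refine imp_of_forall_neg_simple B hQadd hRadd hQpos hRpos fun j hj i hij hi => ?_
    change (rootSystem H).root i ∈ _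
    rw [hij, neg_simple_mem_parabolicSet_iff B ψ hj]
    intro h
    apply h.2
    rw [← hij]
    exact hi
  have hRQ : ∀ i, R i → Q i := by
    refine imp_of_forall_neg_simple B hRadd hQadd hRpos hQpos fun j hj i hij hi => ?_
    change (rootSystem H).root i ∈ _ at hi
    rw [hij, neg_simple_mem_parabolicSet_iff B ψ hj] at hi
    by_cases hjφ : (rootSystem H).root j ∈ φ
    · have : -(rootSystem H).root j ∈ formsOf q.toSubmodule := by
        by_contra h
        exact hi ⟨hjφ, h⟩
      rw [← hij] at this
      exact this
    · apply hQφ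
      rw [hij, neg_simple_mem_parabolicSet_iff B φ hj]
      exact hjφ
  refine ⟨ψ, hψ, ?_⟩
  rw [← LieSubalgebra.toSubmodule_inj]
  refine le_antisymm (toSubmodule_le_of_root_le hHq (le_parabolicSubalgebra B ψ) fun i hi => ?_)
    (toSubmodule_le_of_root_le (le_parabolicSubalgebra B ψ) hHq fun i hi => ?_)
  · exact (rootSpace_le_parabolicSubalgebra_iff B ψ i).2 (hQR i hi)
  · exact hRQ i ((rootSpace_le_parabolicSubalgebra_iff B ψ i).1 hi)

end ParabolicSets

/-! ### The Borel subalgebra of a base, and parabolicity of `𝔮_φ`. -/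

section Borel

open LieAlgebra LieAlgebra.IsKilling Module

/-- A solvable subalgebra contains no `𝔰𝔩₂`-triple. -/
lemma not_isSolvable_of_isSl2Triple {G : Type*} [LieRing G] [LieAlgebra ℂ G]
    {s : LieSubalgebra ℂ G} {h e f : G}
    (t : IsSl2Triple h e f) (hh : h ∈ s) (he : e ∈ s) (hf : f ∈ s) : ¬ IsSolvable s := by
  intro hs
  obtain ⟨k, hk⟩ := IsSolvable.solvable ℂ s
  -- Each of `h`, `e`, `f` is a multiple of a bracket of two of them, so all three survive in every
  -- derived ideal.
  have key : ∀ k, (⟨h, hh⟩ : s) ∈ derivedSeries ℂ s k ∧ (⟨e, he⟩ : s) ∈ derivedSeries ℂ s k ∧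
      (⟨f, hf⟩ : s) ∈ derivedSeries ℂ s k := by
    intro k
    induction k with
    | zero => exact ⟨trivial, trivial, trivial⟩
    | succ k ih =>
      obtain ⟨ihh, ihe, ihf⟩ := ih
      rw [derivedSeries_def, derivedSeriesOfIdeal_succ]
      refine ⟨?_, ?_, ?_⟩
      · have : (⟨h, hh⟩ : s) = ⁅(⟨e, he⟩ : s), (⟨f, hf⟩ : s)⁆ := Subtype.ext t.lie_e_f.symm
        rw [this]
        exact LieSubmodule.lie_mem_lie ihe ihf
      · have : (⟨e, he⟩ : s) = (2⁻¹ : ℂ) • ⁅(⟨h, hh⟩ : s), (⟨e, he⟩ : s)⁆ := by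
          apply Subtype.ext
          change e = (2⁻¹ : ℂ) • ⁅h, e⁆
          rw [t.lie_h_e_smul ℂ, smul_smul]; norm_num
        rw [this]
        exact Submodule.smul_mem _ _ (LieSubmodule.lie_mem_lie ihh ihe)
      · have : (⟨f, hf⟩ : s) = (-2⁻¹ : ℂ) • ⁅(⟨h, hh⟩ : s), (⟨f, hf⟩ : s)⁆ := by
          apply Subtype.ext
          change f = (-2⁻¹ : ℂ) • ⁅h, f⁆
          rw [t.lie_lie_smul_f ℂ, smul_neg, smul_smul]; norm_num
        rw [this]
        exact Submodule.smul_mem _ _ (LieSubmodule.lie_mem_lie ihh ihf)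
  have := (key k).1
  rw [hk, LieSubmodule.mem_bot] at this
  exact t.h_ne_zero (congrArg Subtype.val this)

variable {G : Type*} [LieRing G] [LieAlgebra ℂ G] {H : LieSubalgebra ℂ G} [H.IsCartanSubalgebra]

lemma lie_mem_of_mem_rootSum {T : Set (Dual ℂ H)} {S : Submodule ℂ G}
    (h : ∀ α ∈ T, ∀ β ∈ T, ∀ u ∈ rootSpace H α, ∀ v ∈ rootSpace H β, ⁅u, v⁆ ∈ S)
    {z w : G} (hz : z ∈ rootSum T) (hw : w ∈ rootSum T) : ⁅z, w⁆ ∈ S := by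
  have h1 : ∀ α ∈ T, ∀ u ∈ rootSpace H α, rootSum T ≤ S.comap (ad ℂ G u : G →ₗ[ℂ] G) :=
    fun α hα u hu => rootSum_le fun β hβ v hv => h α hα β hβ u hu v hv
  have h2 : rootSum T ≤ S.comap (ad ℂ G w : G →ₗ[ℂ] G) := by
    refine rootSum_le fun α hα u hu => ?_
    change ⁅w, u⁆ ∈ S
    rw [← lie_skew]
    exact neg_mem (h1 α hα u hu hw)
  rw [← lie_skew]
  exact neg_mem (h2 hz)

variable [FiniteDimensional ℂ G] [LieAlgebra.IsKilling ℂ G]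

/-- The terms of the filtration by height of the Borel subalgebra of a base. -/
def heightSet (B : (rootSystem H).Base) (k : ℕ) : Set (Dual ℂ H) :=
  {χ | (k = 0 ∧ χ = 0) ∨ ∃ i, χ = (rootSystem H).root i ∧ 0 < B.height i ∧ (k : ℤ) ≤ B.height i}

/-- Heights add and are at least 1, so bracketing with a positive root space raises the height. The
form `0` occurs only at level 0, and `H` is abelian; levels 0 and 1 differ just by `H`. -/
lemma lie_mem_rootSum_heightSet (B : (rootSystem H).Base) (k : ℕ) {z w : G}
    (hz : z ∈ rootSum (heightSet B k)) (hw : w ∈ rootSum (heightSet B k)) :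
    ⁅z, w⁆ ∈ rootSum (heightSet B (k + 1)) := by
  refine lie_mem_of_mem_rootSum ?_ hz hw
  intro α hα β hβ u hu v hv
  have huv : ⁅u, v⁆ ∈ rootSpace H ((α + β : Dual ℂ H) : H → ℂ) :=
    lie_mem_genWeightSpace_of_mem_genWeightSpace hu hv
  by_cases h0 : ⁅u, v⁆ = 0
  · rw [h0]; exact zero_mem _
  refine rootSpace_le_rootSum (χ := α + β) ?_ huv
  right
  rcases hα with ⟨rfl, rfl⟩ | ⟨i, rfl, hi, hik⟩
  · rcases hβ with ⟨-, rfl⟩ | ⟨j, rfl, hj, hjk⟩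
    · refine absurd ?_ h0
      have hu' : u ∈ H := by
        have : u ∈ (rootSpace H ((0 : Dual ℂ H) : H → ℂ)).toSubmodule := hu
        rwa [rootSpace_zero_toSubmodule] at this
      have hv' : v ∈ H := by
        have : v ∈ (rootSpace H ((0 : Dual ℂ H) : H → ℂ)).toSubmodule := hv
        rwa [rootSpace_zero_toSubmodule] at this
      exact congrArg Subtype.val (trivial_lie_zero H H ⟨u, hu'⟩ ⟨v, hv'⟩)
    · exact ⟨j, zero_add _, hj, by push_cast; omega⟩
  · rcases hβ with ⟨rfl, rfl⟩ | ⟨j, rfl, hj, hjk⟩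
    · exact ⟨i, add_zero _, hi, by push_cast; omega⟩
    · have hne : (rootSystem H).root i + (rootSystem H).root j ≠ 0 := by
        intro h
        have hij : (rootSystem H).root i = -(rootSystem H).root j := eq_neg_of_add_eq_zero_left h
        obtain ⟨n, -, -, e⟩ := B.exists_root_eq_sum_int j
        have e' : (rootSystem H).root i = ∑ k ∈ B.support, (-n) k • (rootSystem H).root k := by
          simp [hij, e]
        rw [RootPairing.Base.height_eq_sum e] at hj
        rw [RootPairing.Base.height_eq_sum e'] at hi
        simp only [Pi.neg_apply, Finset.sum_neg_distrib] at hi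
        omega
      obtain ⟨l, hl⟩ := mem_range_root hne huv h0
      have := B.height_add hl
      exact ⟨l, hl.symm, by omega, by push_cast; omega⟩

/-- The Borel subalgebra of a base. -/
abbrev baseBorel (B : (rootSystem H).Base) : LieSubalgebra ℂ G :=
  parabolicSubalgebra B (simpleRoots B)

lemma isSolvable_baseBorel (B : (rootSystem H).Base) : IsSolvable (baseBorel B) := by
  have key : ∀ k, ∀ x ∈ derivedSeries ℂ (baseBorel B) k, (x : G) ∈ rootSum (heightSet B k) := by
    intro k
    induction k with
    | zero =>
      intro x _
      have hx : (x : G) ∈ (baseBorel B).toSubmodule := x.2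
      rw [parabolicSubalgebra_toSubmodule] at hx
      refine (rootSum_le fun χ hχ => rootSpace_le_rootSum ?_) hx
      rcases hχ with rfl | hχ
      · exact Or.inl ⟨rfl, rfl⟩
      · obtain ⟨i, rfl⟩ := hχ.1
        have := (mem_parabolicSet_simpleRoots_iff B i).1 hχ
        rw [RootPairing.Base.isPos_iff] at this
        exact Or.inr ⟨i, rfl, this, by push_cast; omega⟩
    | succ k ih =>
      intro x hx
      rw [derivedSeries_def, derivedSeriesOfIdeal_succ, ← LieSubmodule.mem_toSubmodule,
        LieSubmodule.lieIdeal_oper_eq_linear_span'] at hx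
      induction hx using Submodule.span_induction with
      | zero => exact zero_mem _
      | add a b _ _ ha hb => exact add_mem ha hb
      | smul c a _ ha => exact Submodule.smul_mem _ c ha
      | mem a ha =>
        obtain ⟨y, hy, z, hz, rfl⟩ := ha
        exact lie_mem_rootSum_heightSet B k (ih y hy) (ih z hz)
  obtain ⟨N, hN⟩ := (Set.finite_range fun i : H.root => B.height i).bddAbove
  -- `N` bounds all heights, so no root reaches level `N.toNat + 1`; `toNat` covers a negative
  -- bound.
  refine IsSolvable.mk (R := ℂ) (k := N.toNat + 1) ?_
  rw [LieSubmodule.eq_bot_iff]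
  intro x hx
  have hT : heightSet B (N.toNat + 1) = ∅ := by
    refine Set.eq_empty_of_forall_notMem ?_
    rintro χ (⟨h, -⟩ | ⟨i, -, -, hi⟩)
    · omega
    · have := hN ⟨i, rfl⟩
      push_cast at hi
      simp only at this
      omega
  have := key _ x hx
  rw [hT, rootSum] at this
  simp only [Set.mem_empty_iff_false, iSup_false, iSup_bot, Submodule.mem_bot] at this
  exact Subtype.ext this

/-- A larger subalgebra would contain the root space of some negative root along with that of its
opposite, hence an `𝔰𝔩₂`-triple, and could not be solvable. -/
lemma isBorel_baseBorel (B : (rootSystem H).Base) : IsBorel (baseBorel B) := by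
  refine ⟨isSolvable_baseBorel B, fun s hs hle => ?_⟩
  have hHs : H ≤ s := (le_parabolicSubalgebra B _).trans hle
  refine toSubmodule_le_of_root_le (N := (baseBorel B).toSubmodule) hHs
    (le_parabolicSubalgebra B _) fun i hi => ?_
  rw [rootSpace_le_parabolicSubalgebra_iff, mem_parabolicSet_simpleRoots_iff]
  obtain ⟨j, hj⟩ := exists_neg_root i
  refine (isPos_or_isPos_of_eq_neg B hj).resolve_right fun hpos => ?_
  have hjs : (rootSpace H ((rootSystem H).root j)).toSubmodule ≤ s.toSubmodule :=
    ((rootSpace_le_parabolicSubalgebra_iff B _ j).2 (mem_parabolicSet_of_isPos hpos _)).trans hle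
  obtain ⟨h, e, f, t, he, hf⟩ :=
    exists_isSl2Triple_of_weight_isNonZero (LieSubalgebra.isNonZero_coe_root i)
  have he' : e ∈ s := hi he
  have hf' : f ∈ s := by
    apply hjs
    rw [hj]
    exact hf
  refine not_isSolvable_of_isSl2Triple t ?_ he' hf' hs
  rw [← t.lie_e_f]
  exact s.lie_mem he' hf'

/-- The subalgebras `𝔮_φ` are parabolic. -/
lemma isParabolic_parabolicSubalgebra (B : (rootSystem H).Base) {φ : Set (Dual ℂ H)}
    (hφ : φ ⊆ simpleRoots B) : IsParabolic (parabolicSubalgebra B φ) := by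
  refine ⟨baseBorel B, isBorel_baseBorel B, ?_⟩
  refine toSubmodule_le_of_root_le (N := (parabolicSubalgebra B φ).toSubmodule)
    (le_parabolicSubalgebra B _) (le_parabolicSubalgebra B φ) fun i hi => ?_
  rw [rootSpace_le_parabolicSubalgebra_iff] at hi ⊢
  exact parabolicSet_antitone B hφ hi

end Borel

/-! ### Conjugation, rigidity of equivariant maps, and the CR condition. -/

section Conjugation

variable {L : Type*} [LieRing L] [LieAlgebra ℝ L]

@[simp] lemma conj_conj (z : Cx L) : conj (conj z) = z := by
  obtain ⟨x, y, rfl⟩ := exists_re_im z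
  simp

lemma conj_lie (z w : Cx L) : conj ⁅z, w⁆ = ⁅conj z, conj w⁆ := by
  obtain ⟨x, y, rfl⟩ := exists_re_im z
  obtain ⟨x', y', rfl⟩ := exists_re_im w
  simp only [map_add, conj_tmul, add_lie, LieRing.lie_add, LieAlgebra.ExtendScalars.bracket_tmul,
    map_mul]

lemma mem_map_conj_iff {S : Submodule ℂ (Cx L)} {z : Cx L} : z ∈ S.map conj ↔ conj z ∈ S := by
  constructor
  · rintro ⟨w, hw, rfl⟩
    rwa [conj_conj]
  · intro h
    exact ⟨conj z, h, conj_conj z⟩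

/-- The complexified isotropy `𝔮 ∩ σ(𝔮)` as a subalgebra. -/
def CRAlgebra.isotropySubalgebra (A : CRAlgebra L) : LieSubalgebra ℂ (Cx L) where
  toSubmodule := A.cxIsotropy
  lie_mem' {z w} hz hw := by
    refine ⟨A.q.lie_mem hz.1 hw.1, mem_map_conj_iff.2 ?_⟩
    rw [conj_lie]
    exact A.q.lie_mem (mem_map_conj_iff.1 hz.2) (mem_map_conj_iff.1 hw.2)

namespace CRAlgebra.Hom

variable {A A' : CRAlgebra L}

/-- An equivariant homomorphism onto is the identity if `L` has trivial center. -/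
lemma toLieHom_eq_self [LieModule.IsFaithful ℝ L L] (F : Hom A A') (hF : F.IsEquivariant)
    (hF' : F.IsOnto) (x : L) : F.toLieHom x = x := by
  rw [← sub_eq_zero, ← LieSubmodule.mem_bot (R := ℝ) (L := L),
    ← LieAlgebra.center_eq_bot ℝ L, LieModule.mem_maxTrivSubmodule]
  intro w
  obtain ⟨y, rfl⟩ := hF' w
  have h := hF x y
  rw [LieHom.map_lie] at h
  rw [← lie_skew, sub_lie, h, sub_self, neg_zero]

lemma cxMap_eq_id [LieModule.IsFaithful ℝ L L] (F : Hom A A') (hF : F.IsEquivariant)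
    (hF' : F.IsOnto) : cxMap F.toLieHom = LinearMap.id := by
  have : (F.toLieHom : L →ₗ[ℝ] L) = LinearMap.id :=
    LinearMap.ext (F.toLieHom_eq_self hF hF')
  rw [cxMap, this, LinearMap.baseChange_id]

/-- The differential is now a projection between quotients of one space, so both sides are images in
the quotient by `A'.cxIsotropy`; pulling back compares `𝔮 + 𝔮' ∩ σ(𝔮')` with `𝔮'`. One inclusion is
automatic from `𝔮 ≤ 𝔮'`. -/
lemma isCRFibration_iff (F : Hom A A') (hF : cxMap F.toLieHom = LinearMap.id) :
    F.IsCRFibration ↔ A'.q.toSubmodule ≤ A.q.toSubmodule ⊔ A'.cxIsotropy := by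
  have hle : A.q.toSubmodule ≤ A'.q.toSubmodule := fun z hz => by
    simpa [hF] using F.map_mem z hz
  have h1 : A.tangent01.map F.differential = A.q.toSubmodule.map A'.cxIsotropy.mkQ := by
    rw [tangent01, ← Submodule.map_comp, differential, Submodule.mapQ_mkQ, hF, LinearMap.comp_id]
  rw [IsCRFibration, h1, tangent01]
  constructor
  · intro h
    have := congrArg (Submodule.comap A'.cxIsotropy.mkQ) h
    rw [Submodule.comap_map_mkQ, Submodule.comap_map_mkQ] at this
    rw [sup_comm, this]
    exact le_sup_right
  · intro h
    refine le_antisymm (Submodule.map_mono hle) ?_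
    rw [Submodule.map_le_iff_le_comap, Submodule.comap_map_mkQ, sup_comm]
    exact h

end CRAlgebra.Hom

end Conjugation

/-! ### The action of `σ` on roots, and the CR condition in terms of roots. -/

section ConjugationRoots

variable {L : Type*} [LieRing L] [LieAlgebra ℝ L] {h : LieSubalgebra ℝ L}

open LieAlgebra LieAlgebra.IsKilling Module

@[simp] lemma conjDual_conjDual (α : Dual ℂ (complexify h)) : conjDual (conjDual α) = α := by
  ext X
  change starRingEnd ℂ (starRingEnd ℂ (α ⟨conj (conj (X : Cx L)), _⟩)) = α X
  simp

lemma conjDual_neg (α : Dual ℂ (complexify h)) : conjDual (-α) = -conjDual α := by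
  ext X
  exact map_neg (starRingEnd ℂ) _

variable [Module.Finite ℝ L] [LieAlgebra.IsSemisimple ℝ L] [h.IsCartanSubalgebra]

/-- `H` acts semisimply, so generalized weight vectors are eigenvectors, to which `σ` can be applied
directly. -/
lemma mem_rootSpace_iff_forall_lie {G : Type*} [LieRing G] [LieAlgebra ℂ G]
    [FiniteDimensional ℂ G] [LieAlgebra.IsKilling ℂ G] {H : LieSubalgebra ℂ G}
    [H.IsCartanSubalgebra] {χ : H → ℂ} {x : G} :
    x ∈ rootSpace H χ ↔ ∀ y : H, ⁅(y : G), x⁆ = χ y • x := by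
  constructor
  · exact fun hx y => lie_eq_smul_of_mem_rootSpace hx y
  · intro hx
    exact LieModule.weightSpace_le_genWeightSpace G χ ((LieModule.mem_weightSpace _ x).2 hx)

lemma conj_mem_rootSpace {χ : Dual ℂ (complexify h)} {x : Cx L}
    (hx : x ∈ rootSpace (complexify h) χ) : conj x ∈ rootSpace (complexify h) (conjDual χ) := by
  rw [mem_rootSpace_iff_forall_lie] at hx ⊢
  intro y
  have := congrArg conj (hx ⟨conj y, conj_mem_complexify h y.2⟩)
  rw [conj_lie, conj_conj, LinearMap.map_smulₛₗ] at this
  exact this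

lemma conjDual_mem_range_root {β : Dual ℂ (complexify h)}
    (hβ : β ∈ Set.range (rootSystem (complexify h)).root) :
    conjDual β ∈ Set.range (rootSystem (complexify h)).root := by
  obtain ⟨i, rfl⟩ := hβ
  obtain ⟨x, hx, hx0⟩ := i.1.exists_ne_zero
  refine mem_range_root ?_ (conj_mem_rootSpace (χ := (rootSystem (complexify h)).root i) hx) ?_
  · intro h0
    apply (rootSystem (complexify h)).ne_zero i
    rw [← conjDual_conjDual ((rootSystem (complexify h)).root i), h0]
    ext X
    exact map_zero (starRingEnd ℂ)
  · intro h0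
    apply hx0
    rw [← conj_conj x, h0, map_zero]

lemma rootSpace_le_map_conj_iff (χ : Dual ℂ (complexify h)) (S : Submodule ℂ (Cx L)) :
    (rootSpace (complexify h) χ).toSubmodule ≤ S.map conj ↔
      (rootSpace (complexify h) (conjDual χ)).toSubmodule ≤ S := by
  constructor
  · intro H x hx
    have h1 := conj_mem_rootSpace (χ := conjDual χ) hx
    rw [conjDual_conjDual] at h1
    simpa using mem_map_conj_iff.1 (H h1)
  · intro H x hx
    exact mem_map_conj_iff.2 (H (conj_mem_rootSpace hx))

variable (B : (rootSystem (complexify h)).Base)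

lemma rootSpace_le_cxIsotropy_iff (ψ : Set (Dual ℂ (complexify h))) (i : (complexify h).root) :
    (rootSpace (complexify h) ((rootSystem (complexify h)).root i)).toSubmodule ≤
        (parabolicCRAlgebra B ψ).cxIsotropy ↔
      (rootSystem (complexify h)).root i ∈ parabolicSet B ψ ∧
        conjDual ((rootSystem (complexify h)).root i) ∈ parabolicSet B ψ := by
  obtain ⟨j, hj⟩ := conjDual_mem_range_root (h := h) ⟨i, rfl⟩
  rw [CRAlgebra.cxIsotropy, le_inf_iff, rootSpace_le_map_conj_iff, ← hj]
  exact and_congr (rootSpace_le_parabolicSubalgebra_iff B ψ i)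
    (rootSpace_le_parabolicSubalgebra_iff B ψ j)

lemma complexify_le_isotropySubalgebra (ψ : Set (Dual ℂ (complexify h))) :
    complexify h ≤ (parabolicCRAlgebra B ψ).isotropySubalgebra := fun _ hz =>
  ⟨le_parabolicSubalgebra B ψ hz,
    mem_map_conj_iff.2 (le_parabolicSubalgebra B ψ (conj_mem_complexify h hz))⟩

/-- All the subalgebras involved contain `𝔥`, so the inclusion is tested one root space at a time;
`𝔤_β ≤ σ(𝔮_ψ)` means `σ(β) ∈ 𝓠_ψ`. -/
lemma parabolicSubalgebra_le_sup_cxIsotropy_iff (φ ψ : Set (Dual ℂ (complexify h))) :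
    (parabolicSubalgebra B ψ).toSubmodule ≤
        (parabolicSubalgebra B φ).toSubmodule ⊔ (parabolicCRAlgebra B ψ).cxIsotropy ↔
      ∀ β ∈ parabolicSet B ψ, β ∈ parabolicSet B φ ∨ conjDual β ∈ parabolicSet B ψ := by
  have key := fun i => rootSpace_le_sup_iff i (le_parabolicSubalgebra B φ)
    (complexify_le_isotropySubalgebra B ψ)
  constructor
  · intro H β hβ
    obtain ⟨i, rfl⟩ := hβ.1
    have h1 := ((rootSpace_le_parabolicSubalgebra_iff B ψ i).2 hβ).trans H
    refine ((key i).1 h1).imp (rootSpace_le_parabolicSubalgebra_iff B φ i).1 fun h2 => ?_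
    exact ((rootSpace_le_cxIsotropy_iff B ψ i).1 h2).2
  · intro H
    refine toSubmodule_le_of_root_le (le_parabolicSubalgebra B ψ)
      (le_sup_of_le_left (le_parabolicSubalgebra B φ)) fun i hi => (key i).2 ?_
    have hi' := (rootSpace_le_parabolicSubalgebra_iff B ψ i).1 hi
    exact (H _ hi').imp (rootSpace_le_parabolicSubalgebra_iff B φ i).2
      fun h2 => (rootSpace_le_cxIsotropy_iff B ψ i).2 ⟨hi', h2⟩

lemma forall_mem_parabolicSet_iff_nilpotentSet_inter_subset (φ ψ : Set (Dual ℂ (complexify h))) :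
    (∀ β ∈ parabolicSet B ψ, β ∈ parabolicSet B φ ∨ conjDual β ∈ parabolicSet B ψ) ↔
      nilpotentSet B φ ∩ conjDual '' nilpotentSet B ψ ⊆ nilpotentSet B ψ := by
  have hneg : ∀ β ∈ Set.range (rootSystem (complexify h)).root,
      -β ∈ Set.range (rootSystem (complexify h)).root := by
    rintro _ ⟨i, rfl⟩
    exact exists_neg_root i
  constructor
  · rintro H _ ⟨hγ, δ, hδ, rfl⟩
    rw [mem_nilpotentSet_iff B ψ hγ.1.1]
    intro h1
    rcases H _ h1 with h2 | h2
    · exact hγ.2 h2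
    · rw [conjDual_neg, conjDual_conjDual] at h2
      exact hδ.2 h2
  · intro H β hβ
    by_contra! hc
    have hr := hneg β hβ.1
    have h1 : -β ∈ nilpotentSet B φ := by
      rw [mem_nilpotentSet_iff B φ hr, neg_neg]; exact hc.1
    have h2 : -β ∈ conjDual '' nilpotentSet B ψ := by
      refine ⟨conjDual (-β), ?_, conjDual_conjDual _⟩
      rw [mem_nilpotentSet_iff B ψ (conjDual_mem_range_root hr), conjDual_neg, neg_neg]
      exact hc.2
    exact (H ⟨h1, h2⟩).2 (by rwa [neg_neg])

end ConjugationRoots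

end CRAlg

end

theorem mainTheorem6 {L : Type*} [LieRing L] [LieAlgebra ℝ L] [Module.Finite ℝ L]
    [LieAlgebra.IsSemisimple ℝ L] (h : LieSubalgebra ℝ L) [h.IsCartanSubalgebra]
    (B : (LieAlgebra.IsKilling.rootSystem (CRAlg.complexify h)).Base)
    (φ : Set (Module.Dual ℂ (CRAlg.complexify h))) (hφ : φ ⊆ CRAlg.simpleRoots B)
    (A' : CRAlg.CRAlgebra L) (F : (CRAlg.parabolicCRAlgebra B φ).Hom A')
    (hF : F.IsEquivariant) (hF' : F.IsOnto) :
    CRAlg.IsParabolic A'.q ∧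
    (∃ ψ ⊆ φ, A' = CRAlg.parabolicCRAlgebra B ψ) ∧
    ∀ ψ ⊆ φ, A' = CRAlg.parabolicCRAlgebra B ψ →
      (F.IsCRFibration ↔
        CRAlg.nilpotentSet B φ ∩ CRAlg.conjDual '' CRAlg.nilpotentSet B ψ ⊆
          CRAlg.nilpotentSet B ψ) := by
  have hid := F.cxMap_eq_id hF hF'
  have hle : CRAlg.parabolicSubalgebra B φ ≤ A'.q := fun z hz => by
    simpa [hid] using F.map_mem z hz
  obtain ⟨ψ, hψ, hq⟩ := CRAlg.exists_eq_parabolicSubalgebra B hle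
  refine ⟨?_, ⟨ψ, hψ, ?_⟩, ?_⟩
  · rw [hq]
    exact CRAlg.isParabolic_parabolicSubalgebra B (hψ.trans hφ)
  -- The remaining field of a `CRAlgebra` is a proposition, so equality of the complex subalgebras
  -- suffices.
  · cases A'
    subst hq
    rfl
  · rintro ψ - rfl
    rw [F.isCRFibration_iff hid,
      ← CRAlg.forall_mem_parabolicSet_iff_nilpotentSet_inter_subset]
    exact CRAlg.parabolicSubalgebra_le_sup_cxIsotropy_iff B φ ψ
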